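/- For $n\ge 0$ let $\mathcal F_{n,1}=\{\pi\in S_n:|\pi(i)-i|\le 1\text{ for all } i\in[n]\}$ be the set of Fibonacci permutations. The greedy-order algorithm ${\tt A}_g$ generates a random $\pi\in\mathcal F_{n,1}$ as follows. Initially no index is matched. Given the matches made so far, the allowable options for an index $i$ are the values $v$ such that some permutation in $\mathcal F_{n,1}$ agrees with all the matches made so far and maps $i$ to $v$; an index that has not been matched and has only one allowable option is called forced. In each step, the second smallest index among those that are neither matched nor forced is matched with one of its allowable options, chosen uniformly at random. The algorithm stops, and outputs $\pi$, when every index is matched or forced (it never happens that exactly one index is neither). Let $P_g(\pi)$ be the probability that ${\tt A}_g$ outputs $\pi$, and put $T_g(\pi)=P_g(\pi)^{-1}$. **Theorem.** Let $\pi$ be uniformly random in $\mathcal F_{n,1}$. Then, as $n\to\infty$, \[ \frac{\log T_g(\pi)-\mu_g n}{\sigma_g\sqrt n}\ \xrightarrow{d}\ N(0,1), \] where \[ \mu_g=\frac{\log 3}{\sqrt5}\approx 0.4913,\qquad \sigma_g^2=\Bigl(1-\frac{11}{5\sqrt5}\Bigr)\log^2 3\approx 0.0195 . \] (The decimal values are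 correct to within $5\cdot 10^{-5}$.) -/

import Mathlib

/-- Fibonacci permutations of size `n`: the permutations `π` with `|π(i) - i| ≤ 1` for all `i`.
Indices are numbered `0, …, n - 1` (as elements of `Fin n`) instead of `1, …, n`. -/
def FibPerm (n : ℕ) : Type :=
  {π : Equiv.Perm (Fin n) // ∀ i, |((π i : ℕ) : ℤ) - ((i : ℕ) : ℤ)| ≤ 1}

namespace FibPerm

noncomputable instance (n : ℕ) : Fintype (FibPerm n) := by
  classical
  unfold FibPerm
  infer_instance

instance (n : ℕ) : Nonempty (FibPerm n) := ⟨⟨1, fun i => by simp⟩⟩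

instance (n : ℕ) : MeasurableSpace (FibPerm n) := ⊤

/-- The uniform probability measure on Fibonacci permutations of size `n`. -/
noncomputable def uniform (n : ℕ) : MeasureTheory.Measure (FibPerm n) :=
  (PMF.uniformOfFintype (FibPerm n)).toMeasure

instance (n : ℕ) : MeasureTheory.IsProbabilityMeasure (uniform n) := by
  unfold uniform
  infer_instance

end FibPerm

namespace Greedy

/-- The state of the algorithm: `s i = some v` if index `i` has been directly matched with `v`,
and `s i = none` if `i` has not been directly matched so far. -/
abbrev State (n : ℕ) : Type := Fin n → Option (Fin n)

open Classical in
/-- The Fibonacci permutations that agree with all the matches made so far. -/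
noncomputable def completions {n : ℕ} (s : State n) : Finset (FibPerm n) :=
  Finset.univ.filter fun π => ∀ i v, s i = some v → π.1 i = v

open Classical in
/-- The allowable options for index `i`: the values `v` such that `i` can be matched with `v` and
what remains can still be completed to a Fibonacci permutation. -/
noncomputable def options {n : ℕ} (s : State n) (i : Fin n) : Finset (Fin n) :=
  (completions s).image fun π => π.1 i

/-- The indices that are neither matched nor forced: those with at least two allowable options. -/
noncomputable def undetermined {n : ℕ} (s : State n) : Finset (Fin n) :=
  Finset.univ.filter fun i => 2 ≤ (options s i).card

open Classical in
/-- The undetermined indices other than the smallest one; if there are any, then the smallest of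
them is the second smallest undetermined index. -/
noncomputable def nonSmallest {n : ℕ} (s : State n) : Finset (Fin n) :=
  (undetermined s).filter fun i => ∃ j ∈ undetermined s, j < i

theorem options_nonempty {n : ℕ} (s : State n) (i : Fin n) (hi : i ∈ nonSmallest s) :
    (options s i).Nonempty := by
  have h := (Finset.mem_filter.mp (Finset.mem_filter.mp hi).1).2
  exact Finset.card_pos.mp (by omega)

/-- If `nonSmallest s` is empty, then every index is matched or forced: a single undetermined index
cannot occur, because all but one value of a permutation determine the last one. -/
theorem undetermined_eq_empty {n : ℕ} (s : State n) (h : ¬ (nonSmallest s).Nonempty) :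
    undetermined s = ∅ := by
  classical
  by_contra hne
  obtain ⟨i, hi⟩ := Finset.nonempty_iff_ne_empty.mpr hne
  have huniq : ∀ j ∈ undetermined s, j = i := by
    intro j hj
    by_contra hji
    rcases lt_or_gt_of_ne hji with hlt | hlt
    · exact h ⟨i, Finset.mem_filter.mpr ⟨hi, j, hj, hlt⟩⟩
    · exact h ⟨j, Finset.mem_filter.mpr ⟨hj, i, hi, hlt⟩⟩
  have hc := (Finset.mem_filter.mp hi).2
  obtain ⟨a, ha, b, hb, hab⟩ := Finset.one_lt_card.mp (show 1 < (options s i).card by omega)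
  obtain ⟨π, hπ, rfl⟩ := Finset.mem_image.mp ha
  obtain ⟨ρ, hρ, rfl⟩ := Finset.mem_image.mp hb
  have hagree : ∀ j, j ≠ i → π.1 j = ρ.1 j := by
    intro j hj
    by_contra hne
    refine hj (huniq j (Finset.mem_filter.mpr ⟨Finset.mem_univ _, ?_⟩))
    exact Finset.one_lt_card.mpr ⟨_, Finset.mem_image_of_mem _ hπ, _,
      Finset.mem_image_of_mem _ hρ, hne⟩
  obtain ⟨k, hk⟩ := ρ.1.surjective (π.1 i)
  by_cases hki : k = i
  · subst hki
    exact hab hk.symm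
  · exact hki (π.1.injective ((hagree k hki).trans hk))

open Classical in
/-- One step of the algorithm: match the second smallest undetermined index with one of its
allowable options, chosen uniformly at random. If no index is undetermined, the algorithm has
terminated and the state no longer changes. -/
noncomputable def step {n : ℕ} (s : State n) : PMF (State n) :=
  if h : (nonSmallest s).Nonempty then
    (PMF.uniformOfFinset (options s ((nonSmallest s).min' h))
      (options_nonempty s _ (Finset.min'_mem _ h))).map
      fun v => Function.update s ((nonSmallest s).min' h) (some v)
  else PMF.pure s

/-- The law of the state after `k` steps from `s`. -/
noncomputable def run {n : ℕ} : ℕ → State n → PMF (State n)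
  | 0, s => PMF.pure s
  | k + 1, s => (step s).bind (run k)

/-- `P(π)`: the probability that the algorithm, started with nothing matched, outputs `π`, that is,
that `π` is the only permutation compatible with its matches. Every step matches a new index, so
the algorithm terminates within `n` steps. -/
noncomputable def P {n : ℕ} (π : FibPerm n) : ℝ :=
  (((run n (fun _ => none)).map completions) {π}).toReal

/-- `T(π) = P(π)⁻¹`. -/
noncomputable def T {n : ℕ} (π : FibPerm n) : ℝ := (P π)⁻¹

/-- `μ = log 3 / √5`. -/
noncomputable def mean : ℝ := Real.log 3 / √5

/-- `σ² = (1 - 11 / (5 √5)) log² 3`. -/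
noncomputable def variance : ℝ := (1 - 11 / (5 * √5)) * Real.log 3 ^ 2

end Greedy

/-! At every stage the permutations still possible are those with a prescribed initial block, cut at
some `m`, and an arbitrary Fibonacci permutation on the remaining `r` indices. The algorithm then
queries `m + 1`. If `r ≥ 3` there are three options: the values `m` and `m + 1` move the cut by 2,
and `m + 2` moves it by 3. If `r = 2` there are two options and the run ends. Hence `log T` is `log
3` times the number of ternary choices, plus `log 2` at most once, and the sum of `exp (i τ log T)`
over all permutations is `weightSum`, with `w (r + 3) = b (2 w (r + 1) + w r)` and `b = exp (i τ log
3)` (`phaseSum_of_cut`).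

At `b = 1` the characteristic roots are the golden ratio, `-1` and minus the inverse golden ratio.
For `b = exp (i s)` the dominant root is multiplied by `exp (i s / √5 - v s ^ 2 / 2 + O(s ^ 3))`,
with `v` the `renewalVariance` (`characteristic_isBigO`). With `s` of order `1 / √n` the cubic error
is `o(1 / n)`, so `n` steps of the rescaled recurrence have the same limit as at `s = 0`
(`tendsto_diagonal_of_recurrence`). Dividing by the number of permutations gives convergence of
characteristic functions to the Gaussian one, and Lévy's continuity theorem concludes. -/

/-! ### Perturbed linear recurrences -/

theorem le_geometric_of_le_mul_add {N : ℕ → ℝ} {p η : ℝ} (hp0 : 0 ≤ p) (hp1 : p < 1) (hη : 0 ≤ η)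
    (m : ℕ) (h : ∀ k < m, N (k + 1) ≤ p * N k + η) : N m ≤ p ^ m * N 0 + η / (1 - p) := by
  have h1 : 0 < 1 - p := by linarith
  induction m with
  | zero => have : 0 ≤ η / (1 - p) := by positivity
            simpa using this
  | succ m ih =>
    have h2 := ih fun k hk => h k (by omega)
    have h3 := h m (by omega)
    have h4 := mul_le_mul_of_nonneg_left h2 hp0
    have h5 : p * (η / (1 - p)) + η = η / (1 - p) := by field_simp; ring
    calc N (m + 1) ≤ p * (p ^ m * N 0 + η / (1 - p)) + η := by linarith
      _ = p ^ (m + 1) * N 0 + (p * (η / (1 - p)) + η) := by ring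
      _ = _ := by rw [h5]

open Filter Topology in
/-- If `E n` solves a linear recurrence whose coefficients sum to `1 + o(1 / n)` and converge to
those with characteristic roots `1`, `-p`, `-p ^ 2`, then `E n n` converges to the same limit as
the solution of the limiting recurrence. -/
theorem tendsto_diagonal_of_recurrence {p : ℝ} (hp0 : 0 < p) (hp1 : p ^ 2 + p = 1)
    {E : ℕ → ℕ → ℂ} {α β : ℕ → ℂ} {e₀ e₁ e₂ : ℂ} {C : ℝ}
    (hrec : ∀ n k, E n (k + 3) = α n * E n (k + 1) + β n * E n k)
    (hC : ∀ n k, k ≤ n → ‖E n k‖ ≤ C)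
    (hδ : Tendsto (fun n : ℕ => (n : ℂ) * (α n + β n - 1)) atTop (𝓝 0))
    (hβ : Tendsto β atTop (𝓝 ((p : ℂ) ^ 3)))
    (h₀ : Tendsto (fun n => E n 0) atTop (𝓝 e₀)) (h₁ : Tendsto (fun n => E n 1) atTop (𝓝 e₁))
    (h₂ : Tendsto (fun n => E n 2) atTop (𝓝 e₂)) :
    Tendsto (fun n => E n n) atTop (𝓝 ((e₂ + e₁ + p ^ 3 * e₀) / (2 + p ^ 3))) := by
  set V : ℂ := e₂ + e₁ + p ^ 3 * e₀ with hV
  set c : ℂ := V / (2 + p ^ 3) with hc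
  have hp2 : p < 1 := by nlinarith
  have hpos : (2 + (p : ℂ) ^ 3) ≠ 0 := by
    have : (2 + p ^ 3 : ℝ) ≠ 0 := by positivity
    exact_mod_cast this
  have hVc : V = (2 + p ^ 3) * c := by rw [hc]; field_simp
  have hC0 : 0 ≤ C := (norm_nonneg _).trans (hC 0 0 le_rfl)
  have hp1' : (p : ℂ) ^ 2 = 1 - p := by
    have : p ^ 2 = 1 - p := by linarith
    exact_mod_cast this
  set W : ℕ → ℕ → ℂ := fun n k => E n k - c with hW
  set V' : ℕ → ℕ → ℂ := fun n k => E n (k + 2) + E n (k + 1) + β n * E n k with hV'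
  -- A norm adapted to the roots `-p`, `-p ^ 2` of `x ^ 2 + x + p ^ 3`. The weight `p ^ 3 = p - p ^
  -- 2` makes one step contract it by exactly the factor `p`, up to the error `η`.
  set N : ℕ → ℕ → ℝ := fun n k => ‖W n (k + 1) + p * W n k‖ + p ^ 3 * ‖W n k‖ with hN
  set η : ℕ → ℝ := fun n =>
    ‖(n : ℂ) * (α n + β n - 1)‖ * C + ‖V' n 0 - V‖ + ‖(p : ℂ) ^ 3 - β n‖ * C with hη
  have hη0 : ∀ n, 0 ≤ η n := fun n => by positivity
  -- If `α + β = 1`, then `V'` is conserved, which reflects the root 1. In general each step changes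
  -- it by `(α + β - 1) * E (k + 1)`, so the total drift over at most `n` steps tends to zero.
  have hA : ∀ n k, k + 2 ≤ n → ‖V' n k - V' n 0‖ ≤ k * (‖α n + β n - 1‖ * C) := by
    intro n k hk
    induction k with
    | zero => simp
    | succ k ih =>
      have h1 := ih (by omega)
      have h2 : V' n (k + 1) - V' n 0 = (V' n k - V' n 0) + (α n + β n - 1) * E n (k + 1) := by
        simp only [hV']
        rw [show k + 1 + 2 = k + 3 from rfl, hrec]
        ring
      rw [h2]
      refine (norm_add_le _ _).trans ?_
      rw [norm_mul]
      have h3 := mul_le_mul_of_nonneg_left (hC n (k + 1) (by omega)) (norm_nonneg (α n + β n - 1))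
      push_cast
      linarith
  have hB : ∀ n k, k + 2 ≤ n → ‖W n (k + 2) + W n (k + 1) + p ^ 3 * W n k‖ ≤ η n := by
    intro n k hk
    have h1 : W n (k + 2) + W n (k + 1) + p ^ 3 * W n k
        = (V' n k - V' n 0) + (V' n 0 - V) + (p ^ 3 - β n) * E n k := by
      rw [hVc]; simp only [hW, hV']; ring
    rw [h1]
    refine (norm_add₃_le).trans ?_
    have h2 := hA n k hk
    have h3 : (k : ℝ) * (‖α n + β n - 1‖ * C) ≤ ‖(n : ℂ) * (α n + β n - 1)‖ * C := by
      rw [norm_mul, Complex.norm_natCast, mul_assoc]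
      gcongr
      omega
    have h4 : ‖((p : ℂ) ^ 3 - β n) * E n k‖ ≤ ‖(p : ℂ) ^ 3 - β n‖ * C := by
      rw [norm_mul]
      exact mul_le_mul_of_nonneg_left (hC n k (by omega)) (norm_nonneg _)
    simp only [hη]
    linarith
  have hstep : ∀ n k, k + 2 ≤ n → N n (k + 1) ≤ p * N n k + η n := by
    intro n k hk
    -- The combination `W (k + 1) + p * W k` removes the root `-p`, so only the factor `-p ^ 2` is
    -- left.
    have h1 : W n (k + 2) + p * W n (k + 1) = (W n (k + 2) + W n (k + 1) + p ^ 3 * W n k)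
        + (-(p ^ 2 : ℝ) : ℂ) * (W n (k + 1) + p * W n k) := by
      push_cast
      linear_combination (W n (k + 1)) * hp1'
    have h2 : ‖W n (k + 2) + p * W n (k + 1)‖ ≤ η n + p ^ 2 * ‖W n (k + 1) + p * W n k‖ := by
      rw [h1]
      refine (norm_add_le _ _).trans (add_le_add (hB n k hk) ?_)
      rw [norm_mul, norm_neg, Complex.norm_real, Real.norm_of_nonneg (by positivity)]
    have h3 : ‖W n (k + 1)‖ ≤ ‖W n (k + 1) + p * W n k‖ + p * ‖W n k‖ := by
      calc ‖W n (k + 1)‖ = ‖(W n (k + 1) + p * W n k) - p * W n k‖ := by congr 1; ring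
        _ ≤ _ := by
          refine (norm_sub_le _ _).trans (add_le_add le_rfl ?_)
          rw [norm_mul, Complex.norm_real, Real.norm_of_nonneg hp0.le]
    have h4 := mul_le_mul_of_nonneg_left h3 (show 0 ≤ p ^ 3 by positivity)
    have h5 : p ^ 2 + p ^ 3 = p := by
      have : p * (p ^ 2 + p) = p := by rw [hp1]; ring
      nlinarith
    simp only [hN]
    calc _ ≤ η n + p ^ 2 * ‖W n (k + 1) + p * W n k‖
          + p ^ 3 * (‖W n (k + 1) + p * W n k‖ + p * ‖W n k‖) := by linarith
      _ = (p ^ 2 + p ^ 3) * ‖W n (k + 1) + p * W n k‖ + p * (p ^ 3 * ‖W n k‖) + η n := by ring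
      _ = _ := by rw [h5]; ring
  have hbound : ∀ n, ‖W (n + 1) (n + 1)‖
      ≤ (p ^ n * N (n + 1) 0 + η (n + 1) / (1 - p)) / p ^ 3 := by
    intro n
    have h1 := le_geometric_of_le_mul_add (N := N (n + 1)) hp0.le hp2 (hη0 (n + 1)) n
      fun k hk => hstep (n + 1) k (by omega)
    rw [le_div_iff₀ (by positivity)]
    refine le_trans ?_ h1
    have h3 : ‖W (n + 1) (n + 1)‖ ≤ ‖W (n + 1) (n + 1) + p * W (n + 1) n‖ + p * ‖W (n + 1) n‖ := by
      calc ‖W (n + 1) (n + 1)‖ = ‖(W (n + 1) (n + 1) + p * W (n + 1) n) - p * W (n + 1) n‖ := by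
            congr 1; ring
        _ ≤ _ := by
          refine (norm_sub_le _ _).trans (add_le_add le_rfl ?_)
          rw [norm_mul, Complex.norm_real, Real.norm_of_nonneg hp0.le]
    have h6 : p ^ 3 ≤ 1 := pow_le_one₀ hp0.le hp2.le
    have h7 := norm_nonneg (W (n + 1) (n + 1) + p * W (n + 1) n)
    have h8 : p * (p ^ 3 * ‖W (n + 1) n‖) ≤ p ^ 3 * ‖W (n + 1) n‖ :=
      mul_le_of_le_one_left (by positivity) hp2.le
    simp only [hN]
    nlinarith [mul_le_mul_of_nonneg_left h3 (show 0 ≤ p ^ 3 by positivity),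
      mul_le_mul_of_nonneg_right h6 h7]
  have hV0 : Tendsto (fun n => V' n 0) atTop (𝓝 V) := by
    simpa [hV, hV'] using (h₂.add h₁).add (hβ.mul h₀)
  have hηlim : Tendsto η atTop (𝓝 0) := by
    have h1 := (hδ.norm.mul_const C).add (hV0.sub_const V).norm
    have h2 := h1.add (((tendsto_const_nhds (x := (p : ℂ) ^ 3)).sub hβ).norm.mul_const C)
    simpa [hη] using h2
  have hN0 : Tendsto (fun n => N n 0) atTop (𝓝 (‖(e₁ - c) + p * (e₀ - c)‖ + p ^ 3 * ‖e₀ - c‖)) := by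
    have h1 := ((h₁.sub_const c).add ((h₀.sub_const c).const_mul (p : ℂ))).norm
    exact h1.add ((h₀.sub_const c).norm.const_mul (p ^ 3))
  have hlim : Tendsto (fun n => (p ^ n * N (n + 1) 0 + η (n + 1) / (1 - p)) / p ^ 3) atTop
      (𝓝 0) := by
    have h1 := ((tendsto_pow_atTop_nhds_zero_of_lt_one hp0.le hp2).mul
      (hN0.comp (tendsto_add_atTop_nat 1))).add
      ((hηlim.comp (tendsto_add_atTop_nat 1)).div_const (1 - p))
    simpa using h1.div_const (p ^ 3)
  have hfin : Tendsto (fun n => W (n + 1) (n + 1)) atTop (𝓝 0) :=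
    squeeze_zero_norm hbound hlim
  have := hfin.add_const c
  rw [← tendsto_add_atTop_iff_nat 1]
  simpa [hW] using this

/-! ### Asymptotics of the weighted count -/

namespace Greedy

/-- The sum over the Fibonacci permutations of size `n` of the weights `b ^ i * a ^ j`, where `i`
counts the ternary and `j` the binary choices that the greedy-order algorithm makes. -/
def weightSum (a b : ℂ) : ℕ → ℂ
  | 0 => 1
  | 1 => 1
  | 2 => 2 * a
  | n + 3 => b * (2 * weightSum a b (n + 1) + weightSum a b n)

/-- Weights of modulus 1 drop out under the triangle inequality, and `2 * p ^ 2 + p ^ 3 = 1` closes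
the induction. This supplies the uniform bound needed for the perturbed recurrence. -/
theorem norm_weightSum_mul_pow_le {a b : ℂ} (ha : ‖a‖ = 1) (hb : ‖b‖ = 1) {p : ℝ} (hp0 : 0 < p)
    (hp : p ^ 2 + p = 1) (n : ℕ) : ‖weightSum a b n‖ * p ^ n ≤ 1 := by
  have hp3 : 2 * p ^ 2 + p ^ 3 = 1 := by
    linear_combination (p + 1) * hp
  induction n using weightSum.induct with
  | case1 => simp [weightSum]
  | case2 => simp only [weightSum, norm_one]; nlinarith
  | case3 =>
    simp only [weightSum, norm_mul, ha, Complex.norm_ofNat]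
    have := pow_pos hp0 3
    linarith
  | case4 n h1 h2 =>
    rw [weightSum, norm_mul, hb, one_mul]
    have h3 : ‖2 * weightSum a b (n + 1) + weightSum a b n‖
        ≤ 2 * ‖weightSum a b (n + 1)‖ + ‖weightSum a b n‖ := by
      refine (norm_add_le _ _).trans ?_
      rw [norm_mul, Complex.norm_ofNat]
    calc _ ≤ (2 * ‖weightSum a b (n + 1)‖ + ‖weightSum a b n‖) * p ^ (n + 3) := by gcongr
      _ = 2 * p ^ 2 * (‖weightSum a b (n + 1)‖ * p ^ (n + 1))
          + p ^ 3 * (‖weightSum a b n‖ * p ^ n) := by ring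
      _ ≤ 2 * p ^ 2 * 1 + p ^ 3 * 1 := by gcongr
      _ = 1 := by linarith

open Filter Topology Asymptotics in
theorem exp_quadratic_sub_isBigO (A B : ℂ) :
    (fun s : ℂ => Complex.exp (A * s + B * s ^ 2) - (1 + A * s + (B + A ^ 2 / 2) * s ^ 2))
      =O[𝓝 0] fun s => s ^ 3 := by
  have hw0 : Tendsto (fun s : ℂ => A * s + B * s ^ 2) (𝓝 0) (𝓝 0) := by
    have : Continuous fun s : ℂ => A * s + B * s ^ 2 := by fun_prop
    simpa using this.tendsto 0
  have hbdd : ∀ f : ℂ → ℂ, Continuous f → f =O[𝓝 0] fun _ => (1 : ℂ) := fun f hf =>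
    (hf.tendsto 0).isBigO_one ℂ
  have hw : (fun s : ℂ => A * s + B * s ^ 2) =O[𝓝 0] fun s => s := by
    have h := (hbdd (fun s => A + B * s) (by fun_prop)).mul (isBigO_refl (fun s : ℂ => s) (𝓝 0))
    simp only [one_mul] at h
    exact h.congr_left fun s => by ring
  have h1 := ((Complex.exp_sub_sum_range_isBigO_pow 3).comp_tendsto hw0).trans (hw.pow 3)
  have h2 := (hbdd (fun s => A * B + B ^ 2 / 2 * s) (by fun_prop)).mul
    (isBigO_refl (fun s : ℂ => s ^ 3) (𝓝 0))
  simp only [one_mul] at h2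
  refine (h1.add h2).congr_left fun s => ?_
  simp [Finset.sum_range_succ, Nat.factorial]
  ring

/-- The constant in the variance: the renewal variance per unit of length. -/
noncomputable def renewalVariance : ℝ := 1 - 11 / (5 * √5)

/-- The inverse golden ratio. -/
noncomputable def invGolden : ℝ := (√5 - 1) / 2

theorem invGolden_pos : 0 < invGolden := by
  have : 1 < √5 := Real.lt_sqrt_of_sq_lt (by norm_num)
  unfold invGolden
  linarith

theorem invGolden_sq_add : invGolden ^ 2 + invGolden = 1 := by
  have : √5 ^ 2 = 5 := Real.sq_sqrt (by norm_num)
  unfold invGolden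
  linear_combination this / 4

theorem sqrt_five_mem : 2.236067 < √5 ∧ √5 < 2.236068 :=
  ⟨Real.lt_sqrt_of_sq_lt (by norm_num), (Real.sqrt_lt' (by norm_num)).2 (by norm_num)⟩

theorem renewalVariance_pos : 0 < renewalVariance := by
  have h := sqrt_five_mem.1
  have : 11 / (5 * √5) < 1 := by
    rw [div_lt_one (by linarith)]
    linarith
  unfold renewalVariance
  linarith

/-- The approximate logarithmic growth rate of `weightSum a (exp (i s))`, relative to `s = 0`. -/
noncomputable def growthExponent (s : ℂ) : ℂ :=
  Complex.I * s / (√5 : ℝ) - renewalVariance * s ^ 2 / 2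

-- Up to third order, `invGolden * exp (-growthExponent s)` is the reciprocal of the dominant
-- characteristic root. The mean and the variance of the theorem are what this expansion dictates.
open Filter Topology Asymptotics in
theorem characteristic_isBigO :
    (fun s : ℂ => 2 * Complex.exp (Complex.I * s) * (invGolden * Complex.exp (-growthExponent s)) ^ 2
      + Complex.exp (Complex.I * s) * (invGolden * Complex.exp (-growthExponent s)) ^ 3 - 1)
      =O[𝓝 0] fun s => s ^ 3 := by
  obtain ⟨r, hr⟩ : ∃ r : ℂ, r = ((√5 : ℝ) : ℂ) := ⟨_, rfl⟩
  have hr2 : r ^ 2 = 5 := by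
    rw [hr]
    have : √5 ^ 2 = 5 := Real.sq_sqrt (by norm_num)
    exact_mod_cast this
  have hr0 : r ≠ 0 := by
    rintro rfl
    norm_num at hr2
  have hinv : r⁻¹ = r / 5 := by
    field_simp
    exact hr2.symm
  have hp : (invGolden : ℂ) = (r - 1) / 2 := by
    rw [hr]; simp [invGolden]
  have hv : (renewalVariance : ℂ) = 1 - 11 * r / 25 := by
    have h : (renewalVariance : ℂ) = 1 - 11 / 5 * r⁻¹ := by
      rw [hr, renewalVariance]; push_cast; field_simp
    rw [h, hinv]; ring
  have h1 := (exp_quadratic_sub_isBigO (Complex.I * (1 - 2 * r / 5)) renewalVariance).const_mul_left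
    (2 * (invGolden : ℂ) ^ 2)
  have h2 := (exp_quadratic_sub_isBigO (Complex.I * (1 - 3 * r / 5))
    (3 / 2 * renewalVariance)).const_mul_left ((invGolden : ℂ) ^ 3)
  refine (h1.add h2).congr_left fun s => ?_
  have e1 : Complex.exp (Complex.I * s) * Complex.exp (-growthExponent s) ^ 2
      = Complex.exp (Complex.I * (1 - 2 * r / 5) * s + renewalVariance * s ^ 2) := by
    rw [← Complex.exp_nat_mul, ← Complex.exp_add, growthExponent, ← hr, div_eq_mul_inv _ r, hinv]
    congr 1
    push_cast
    ring
  have e2 : Complex.exp (Complex.I * s) * Complex.exp (-growthExponent s) ^ 3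
      = Complex.exp (Complex.I * (1 - 3 * r / 5) * s + 3 / 2 * renewalVariance * s ^ 2) := by
    rw [← Complex.exp_nat_mul, ← Complex.exp_add, growthExponent, ← hr, div_eq_mul_inv _ r, hinv]
    congr 1
    push_cast
    ring
  have e3 : 2 * Complex.exp (Complex.I * s) * (invGolden * Complex.exp (-growthExponent s)) ^ 2
      + Complex.exp (Complex.I * s) * (invGolden * Complex.exp (-growthExponent s)) ^ 3 - 1
      = 2 * (invGolden : ℂ) ^ 2 * (Complex.exp (Complex.I * s) * Complex.exp (-growthExponent s) ^ 2)
      + (invGolden : ℂ) ^ 3 * (Complex.exp (Complex.I * s) * Complex.exp (-growthExponent s) ^ 3)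
      - 1 := by ring
  rw [e3, e1, e2]
  generalize Complex.exp (Complex.I * (1 - 2 * r / 5) * s + renewalVariance * s ^ 2) = x
  generalize Complex.exp (Complex.I * (1 - 3 * r / 5) * s + 3 / 2 * renewalVariance * s ^ 2) = y
  have hp2 : (invGolden : ℂ) ^ 2 = (3 - r) / 2 := by rw [hp]; linear_combination hr2 / 4
  have hp3 : (invGolden : ℂ) ^ 3 = r - 2 := by
    rw [pow_succ, hp2, hp]; linear_combination -hr2 / 4
  -- The Taylor coefficients of orders 0, 1 and 2 vanish: `c0` because of the golden ratio, `c1`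
  -- because of the linear coefficient `1 / √5`, `c2` because of the value of `renewalVariance`.
  have c0 : 2 * (invGolden : ℂ) ^ 2 + (invGolden : ℂ) ^ 3 = 1 := by rw [hp2, hp3]; ring
  have c1 : 2 * (invGolden : ℂ) ^ 2 * (Complex.I * (1 - 2 * r / 5))
      + (invGolden : ℂ) ^ 3 * (Complex.I * (1 - 3 * r / 5)) = 0 := by
    rw [hp2, hp3]; linear_combination (-Complex.I / 5) * hr2
  have c2 : 2 * (invGolden : ℂ) ^ 2 * (renewalVariance + (Complex.I * (1 - 2 * r / 5)) ^ 2 / 2)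
      + (invGolden : ℂ) ^ 3 * (3 / 2 * renewalVariance + (Complex.I * (1 - 3 * r / 5)) ^ 2 / 2)
      = 0 := by
    rw [hp2, hp3, hv, mul_pow, mul_pow, Complex.I_sq]
    have hr3 : r ^ 3 = 5 * r := by rw [pow_succ, hr2]
    ring_nf
    rw [hr3, hr2]
    ring
  linear_combination -c0 - s * c1 - s ^ 2 * c2

open Filter Topology in
theorem tendsto_div_sqrt (c : ℝ) : Tendsto (fun n : ℕ => c / √(n : ℝ)) atTop (𝓝 0) :=
  tendsto_const_nhds.div_atTop (Real.tendsto_sqrt_atTop.comp tendsto_natCast_atTop_atTop)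

/-- The limit of `weightSum 1 1 n * invGolden ^ n`. -/
noncomputable def weightLimit : ℂ :=
  (2 * (invGolden : ℂ) ^ 2 + invGolden + invGolden ^ 3 * 1) / (2 + invGolden ^ 3)

theorem weightLimit_ne_zero : weightLimit ≠ 0 := by
  have h := invGolden_pos
  have : (2 * invGolden ^ 2 + invGolden + invGolden ^ 3 * 1) / (2 + invGolden ^ 3) ≠ 0 := by
    positivity
  unfold weightLimit
  exact_mod_cast this

open Filter Topology in
theorem tendsto_weightSum_mul_pow {a : ℕ → ℂ} (ha : ∀ n, ‖a n‖ = 1) (ha1 : Tendsto a atTop (𝓝 1))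
    (c : ℝ) :
    Tendsto (fun n : ℕ => weightSum (a n) (Complex.exp (Complex.I * (c / √(n : ℝ) : ℝ))) n
      * (invGolden * Complex.exp (-growthExponent (c / √(n : ℝ) : ℝ))) ^ n) atTop
      (𝓝 weightLimit) := by
  set s : ℕ → ℝ := fun n => c / √(n : ℝ) with hs
  set b : ℕ → ℂ := fun n => Complex.exp (Complex.I * (s n)) with hb
  set q : ℕ → ℂ := fun n => invGolden * Complex.exp (-growthExponent (s n)) with hq
  have hs0 : Tendsto (fun n => (s n : ℂ)) atTop (𝓝 0) := by
    have h : Tendsto Complex.ofReal (𝓝 0) (𝓝 0) := Complex.continuous_ofReal.tendsto 0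
    exact h.comp (tendsto_div_sqrt c)
  have hb1 : ∀ n, ‖b n‖ = 1 := fun n => by
    simp only [hb]; rw [mul_comm]; exact Complex.norm_exp_ofReal_mul_I _
  have hbt : Tendsto b atTop (𝓝 1) := by
    have h : Continuous fun z : ℂ => Complex.exp (Complex.I * z) := by fun_prop
    have h0 : Tendsto (fun z : ℂ => Complex.exp (Complex.I * z)) (𝓝 0) (𝓝 1) := by
      simpa using h.tendsto 0
    exact h0.comp hs0
  have hqt : Tendsto q atTop (𝓝 invGolden) := by
    have h : Continuous fun z : ℂ => (invGolden : ℂ) * Complex.exp (-growthExponent z) := by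
      unfold growthExponent; fun_prop
    have h0 : Tendsto (fun z : ℂ => (invGolden : ℂ) * Complex.exp (-growthExponent z)) (𝓝 0)
        (𝓝 invGolden) := by
      simpa [growthExponent] using h.tendsto 0
    exact h0.comp hs0
  -- Rescaling by `q` instead of `invGolden` costs a factor `exp (renewalVariance * k * s ^ 2 / 2)`
  -- in modulus, which stays bounded for `k ≤ n`.
  have hs2 : ∀ n k : ℕ, k ≤ n → k * s n ^ 2 ≤ c ^ 2 := by
    intro n k hk
    rcases Nat.eq_zero_or_pos n with rfl | hn
    · have : k = 0 := by omega
      subst this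
      simp [sq_nonneg]
    · have hn' : (0 : ℝ) < n := by exact_mod_cast hn
      have hk' : (k : ℝ) ≤ n := by exact_mod_cast hk
      simp only [hs]
      rw [div_pow, Real.sq_sqrt hn'.le, mul_div_assoc', div_le_iff₀ hn', mul_comm]
      gcongr
  have hqn : ∀ n, ‖q n‖ = invGolden * Real.exp (renewalVariance * s n ^ 2 / 2) := by
    intro n
    have h : (-growthExponent (s n)).re = renewalVariance * s n ^ 2 / 2 := by
      have h2 : -growthExponent (s n)
          = ((renewalVariance * s n ^ 2 / 2 : ℝ) : ℂ) - ((s n / √5 : ℝ) : ℂ) * Complex.I := by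
        simp only [growthExponent]; push_cast; ring
      rw [h2, Complex.sub_re, Complex.re_ofReal_mul, Complex.I_re, Complex.ofReal_re]
      ring
    simp only [hq]
    rw [norm_mul, Complex.norm_real, Real.norm_of_nonneg invGolden_pos.le, Complex.norm_exp, h]
  refine tendsto_diagonal_of_recurrence invGolden_pos invGolden_sq_add
    (E := fun n k => weightSum (a n) (b n) k * q n ^ k)
    (α := fun n => 2 * b n * q n ^ 2) (β := fun n => b n * q n ^ 3)
    (C := Real.exp (renewalVariance * c ^ 2 / 2)) ?_ ?_ ?_ ?_ ?_ ?_ ?_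
  · intro n k
    simp only [weightSum]
    ring
  · intro n k hk
    rw [norm_mul, norm_pow, hqn, mul_pow, ← mul_assoc, ← Real.exp_nat_mul]
    have h1 := norm_weightSum_mul_pow_le (ha n) (hb1 n) invGolden_pos invGolden_sq_add k
    refine (mul_le_of_le_one_left (Real.exp_pos _).le h1).trans (Real.exp_le_exp.2 ?_)
    have := mul_le_mul_of_nonneg_left (hs2 n k hk) renewalVariance_pos.le
    linarith
  -- Since `n * s ^ 2 = c ^ 2`, the bound `n * O(s ^ 3)` is `O(s)` and tends to zero.
  · have h1 := characteristic_isBigO.comp_tendsto hs0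
    have h2 := (Asymptotics.isBigO_refl (fun n : ℕ => (n : ℂ)) atTop).mul h1
    refine h2.trans_tendsto ?_
    have h3 : Tendsto (fun n : ℕ => ((c ^ 2 : ℝ) : ℂ) * s n) atTop (𝓝 0) := by
      simpa only [mul_zero] using hs0.const_mul ((c ^ 2 : ℝ) : ℂ)
    refine h3.congr' ?_
    filter_upwards [eventually_gt_atTop 0] with n hn
    have hn' : (0 : ℝ) < n := by exact_mod_cast hn
    have h4 : (n : ℝ) * s n ^ 2 = c ^ 2 := by
      simp only [hs]
      rw [div_pow, Real.sq_sqrt hn'.le]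
      field_simp
    rw [← h4]
    simp only [Function.comp_apply]
    push_cast
    ring
  · simpa using hbt.mul (hqt.pow 3)
  · simp [weightSum]
  · simpa [weightSum] using hqt
  · simpa [weightSum] using (ha1.const_mul 2).mul (hqt.pow 2)

-- Numerator and denominator, rescaled by their own growth rates, have the same nonzero limit. The
-- quotient of the growth rates leaves the drift, which is divided out, and the Gaussian factor.
open Filter Topology in
theorem tendsto_weightSum_div {a : ℕ → ℂ} (ha : ∀ n, ‖a n‖ = 1) (ha1 : Tendsto a atTop (𝓝 1))
    (c : ℝ) :
    Tendsto (fun n : ℕ => weightSum (a n) (Complex.exp (Complex.I * (c / √(n : ℝ) : ℝ))) n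
      / weightSum 1 1 n * Complex.exp (-(Complex.I * (c / √(n : ℝ) : ℝ) / (√5 : ℝ) * n))) atTop
      (𝓝 (Complex.exp (-(renewalVariance * c ^ 2 / 2)))) := by
  have h1 := tendsto_weightSum_mul_pow ha ha1 c
  have h2 := tendsto_weightSum_mul_pow (a := fun _ => 1) (by simp) tendsto_const_nhds 0
  have h3 := (h1.div h2 weightLimit_ne_zero).mul_const
    (Complex.exp (-(renewalVariance * c ^ 2 / 2)))
  rw [div_self weightLimit_ne_zero, one_mul] at h3
  refine h3.congr' ?_
  filter_upwards [eventually_gt_atTop 0] with n hn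
  have hn' : (0 : ℝ) < n := by exact_mod_cast hn
  have hp : (invGolden : ℂ) ≠ 0 := by exact_mod_cast invGolden_pos.ne'
  have h4 : (n : ℂ) * ((c / √(n : ℝ) : ℝ) : ℂ) ^ 2 = c ^ 2 := by
    have : (n : ℝ) * (c / √(n : ℝ)) ^ 2 = c ^ 2 := by
      rw [div_pow, Real.sq_sqrt hn'.le]
      field_simp
    exact_mod_cast this
  have h5 : Complex.exp (-growthExponent (c / √(n : ℝ) : ℝ)) ^ n
      * Complex.exp (-(renewalVariance * c ^ 2 / 2))
      = Complex.exp (-(Complex.I * (c / √(n : ℝ) : ℝ) / (√5 : ℝ) * n)) := by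
    rw [← Complex.exp_nat_mul, ← Complex.exp_add, growthExponent, ← h4]
    congr 1
    ring
  rw [← h5]
  simp only [zero_div, Complex.ofReal_zero, mul_zero, Complex.exp_zero, mul_pow, growthExponent,
    ne_eq, OfNat.ofNat_ne_zero, not_false_eq_true, zero_pow, sub_zero, neg_zero, mul_one, Pi.div_apply]
  field_simp

end Greedy

/-! ### Cuts: Fibonacci permutations with a prescribed initial block -/

namespace FibPerm

theorem near {n : ℕ} (π : FibPerm n) (i : Fin n) :
    (π.1 i : ℕ) ≤ i + 1 ∧ (i : ℕ) ≤ π.1 i + 1 := by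
  have := abs_le.1 (π.2 i)
  omega

theorem exists_swap {n : ℕ} (ρ : FibPerm n) {a b : Fin n} (hab : (b : ℕ) = a + 1)
    (ha : ρ.1 a = a) (hb : ρ.1 b = b) :
    ∃ ρ' : FibPerm n, ρ'.1 a = b ∧ ρ'.1 b = a ∧ ∀ i, i ≠ a → i ≠ b → ρ'.1 i = ρ.1 i := by
  have h1 : (ρ.1 * Equiv.swap a b) a = b := by simp [hb]
  have h2 : (ρ.1 * Equiv.swap a b) b = a := by simp [ha]
  have h3 : ∀ i, i ≠ a → i ≠ b → (ρ.1 * Equiv.swap a b) i = ρ.1 i := by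
    intro i hia hib
    simp [Equiv.swap_apply_of_ne_of_ne hia hib]
  refine ⟨⟨ρ.1 * Equiv.swap a b, fun i => ?_⟩, h1, h2, h3⟩
  by_cases hia : i = a
  · subst hia
    rw [h1, abs_le]
    omega
  by_cases hib : i = b
  · subst hib
    rw [h2, abs_le]
    omega
  rw [h3 i hia hib]
  exact ρ.2 i

/-- The permutation `ρ` fixes all indices from `m` on. -/
def FixesFrom {n : ℕ} (ρ : FibPerm n) (m : ℕ) : Prop := ∀ i : Fin n, m ≤ (i : ℕ) → ρ.1 i = i

open Classical in
/-- The Fibonacci permutations that agree with `ρ` on all indices below `m`. -/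
noncomputable def agreeBelow {n : ℕ} (ρ : FibPerm n) (m : ℕ) : Finset (FibPerm n) :=
  Finset.univ.filter fun π => ∀ i : Fin n, (i : ℕ) < m → π.1 i = ρ.1 i

theorem mem_agreeBelow {n : ℕ} {ρ π : FibPerm n} {m : ℕ} :
    π ∈ agreeBelow ρ m ↔ ∀ i : Fin n, (i : ℕ) < m → π.1 i = ρ.1 i := by
  simp [agreeBelow]

theorem self_mem_agreeBelow {n : ℕ} (ρ : FibPerm n) (m : ℕ) : ρ ∈ agreeBelow ρ m :=
  mem_agreeBelow.2 fun _ _ => rfl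

/-- As `ρ` fixes everything from `m` on, its indices below `m` already use up all values below `m`.
-/
theorem le_apply_of_mem_agreeBelow {n : ℕ} {ρ π : FibPerm n} {m : ℕ} (hρ : ρ.FixesFrom m)
    (hπ : π ∈ agreeBelow ρ m) {i : Fin n} (hi : m ≤ (i : ℕ)) : m ≤ (π.1 i : ℕ) := by
  by_contra! h
  obtain ⟨j, hj⟩ := ρ.1.surjective (π.1 i)
  have hjm : (j : ℕ) < m := by
    by_contra! h2
    rw [hρ j h2] at hj
    rw [hj] at h2
    omega
  have h3 : j = i := π.1.injective ((mem_agreeBelow.1 hπ j hjm).trans hj)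
  rw [h3] at hjm
  omega

theorem agreeBelow_eq_singleton {n : ℕ} {ρ : FibPerm n} {m : ℕ} (hρ : ρ.FixesFrom m)
    (hm : n ≤ m + 1) : agreeBelow ρ m = {ρ} := by
  refine Finset.eq_singleton_iff_unique_mem.2 ⟨self_mem_agreeBelow ρ m, fun π hπ => ?_⟩
  refine Subtype.ext (Equiv.ext fun i => ?_)
  by_cases hi : (i : ℕ) < m
  · exact mem_agreeBelow.1 hπ i hi
  · have h1 := le_apply_of_mem_agreeBelow hρ hπ (i := i) (by omega)
    rw [hρ i (by omega)]
    refine Fin.ext ?_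
    have := (π.1 i).2
    have := i.2
    omega

/-- A value of the index `m + 1` singles out a subclass that again consists of the permutations
agreeing with some `ρ'` below a later cut, here `m + 2`. -/
theorem exists_child_fixed {n : ℕ} {ρ : FibPerm n} {m : ℕ} (hρ : ρ.FixesFrom m) (hm : m + 1 < n) :
    ∃ ρ' : FibPerm n, ρ'.FixesFrom (m + 2) ∧ ∀ π, π ∈ agreeBelow ρ' (m + 2) ↔
      π ∈ agreeBelow ρ m ∧ π.1 ⟨m + 1, hm⟩ = ⟨m + 1, hm⟩ := by
  refine ⟨ρ, fun i hi => hρ i (by omega), fun π => ⟨fun h => ?_, fun ⟨h, h1⟩ => ?_⟩⟩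
  · rw [mem_agreeBelow] at h
    exact ⟨mem_agreeBelow.2 fun i hi => h i (by omega),
      (h ⟨m + 1, hm⟩ (by simp)).trans (hρ _ (by simp))⟩
  · rw [mem_agreeBelow]
    intro i hi
    by_cases hi1 : (i : ℕ) < m
    · exact mem_agreeBelow.1 h i hi1
    rw [hρ i (by omega)]
    by_cases hi2 : (i : ℕ) = m + 1
    · have : i = ⟨m + 1, hm⟩ := Fin.ext hi2
      rw [this, h1]
    · have h2 := le_apply_of_mem_agreeBelow hρ h (i := i) (by omega)
      have h3 := (π.near i).1
      have h4 : (π.1 i : ℕ) ≠ m + 1 := fun h4 =>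
        hi2 (congrArg Fin.val (π.1.injective ((Fin.ext h4 : π.1 i = ⟨m + 1, hm⟩).trans h1.symm)))
      exact Fin.ext (by omega)

/-- With the value `m` taken, the only value left for index `m` is `m + 1`. -/
theorem exists_child_swap_left {n : ℕ} {ρ : FibPerm n} {m : ℕ} (hρ : ρ.FixesFrom m)
    (hm : m + 1 < n) :
    ∃ ρ' : FibPerm n, ρ'.FixesFrom (m + 2) ∧ ∀ π, π ∈ agreeBelow ρ' (m + 2) ↔
      π ∈ agreeBelow ρ m ∧ π.1 ⟨m + 1, hm⟩ = ⟨m, by omega⟩ := by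
  obtain ⟨ρ', ha, hb, hc⟩ := ρ.exists_swap (a := ⟨m, by omega⟩) (b := ⟨m + 1, hm⟩) rfl
    (hρ _ le_rfl) (hρ _ (by simp))
  have hc' : ∀ i : Fin n, (i : ℕ) ≠ m → (i : ℕ) ≠ m + 1 → ρ'.1 i = ρ.1 i := fun i h1 h2 =>
    hc i (fun h => h1 (congrArg Fin.val h)) (fun h => h2 (congrArg Fin.val h))
  refine ⟨ρ', fun i hi => (hc' i (by omega) (by omega)).trans (hρ i (by omega)),
    fun π => ⟨fun h => ?_, fun ⟨h, h1⟩ => ?_⟩⟩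
  · rw [mem_agreeBelow] at h
    exact ⟨mem_agreeBelow.2 fun i hi => (h i (by omega)).trans (hc' i (by omega) (by omega)),
      (h ⟨m + 1, hm⟩ (by simp)).trans hb⟩
  · rw [mem_agreeBelow]
    intro i hi
    by_cases hi1 : (i : ℕ) < m
    · rw [hc' i (by omega) (by omega)]
      exact mem_agreeBelow.1 h i hi1
    by_cases hi2 : (i : ℕ) = m + 1
    · have : i = ⟨m + 1, hm⟩ := Fin.ext hi2
      rw [this, h1, hb]
    · have hi3 : i = ⟨m, by omega⟩ := Fin.ext (by simp; omega)
      have h2 := le_apply_of_mem_agreeBelow hρ h (i := i) (by omega)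
      have h3 := (π.near i).1
      have h4 : (π.1 i : ℕ) ≠ m := fun h4 =>
        hi2 (congrArg Fin.val (π.1.injective
          ((Fin.ext h4 : π.1 i = ⟨m, by omega⟩).trans h1.symm)))
      rw [hi3, ha, ← hi3]
      exact Fin.ext (by simp; omega)

/-- Only `m` and `m + 1` could take the value `m`, so `m` is fixed. Then only `m + 2` is left to
take the value `m + 1`. Three indices are settled at once. -/
theorem exists_child_swap_right {n : ℕ} {ρ : FibPerm n} {m : ℕ} (hρ : ρ.FixesFrom m)
    (hm : m + 2 < n) :
    ∃ ρ' : FibPerm n, ρ'.FixesFrom (m + 3) ∧ ∀ π, π ∈ agreeBelow ρ' (m + 3) ↔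
      π ∈ agreeBelow ρ m ∧ π.1 ⟨m + 1, by omega⟩ = ⟨m + 2, hm⟩ := by
  obtain ⟨ρ', ha, hb, hc⟩ := ρ.exists_swap (a := ⟨m + 1, by omega⟩) (b := ⟨m + 2, hm⟩) rfl
    (hρ _ (by simp)) (hρ _ (by simp))
  have hc' : ∀ i : Fin n, (i : ℕ) ≠ m + 1 → (i : ℕ) ≠ m + 2 → ρ'.1 i = ρ.1 i := fun i h1 h2 =>
    hc i (fun h => h1 (congrArg Fin.val h)) (fun h => h2 (congrArg Fin.val h))
  refine ⟨ρ', fun i hi => (hc' i (by omega) (by omega)).trans (hρ i (by omega)),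
    fun π => ⟨fun h => ?_, fun ⟨h, h1⟩ => ?_⟩⟩
  · rw [mem_agreeBelow] at h
    exact ⟨mem_agreeBelow.2 fun i hi => (h i (by omega)).trans (hc' i (by omega) (by omega)),
      (h ⟨m + 1, by omega⟩ (by simp)).trans ha⟩
  · have hm0 : π.1 ⟨m, by omega⟩ = ⟨m, by omega⟩ := by
      by_contra hne
      have hpre : ∃ j, π.1 j = ⟨m, by omega⟩ := π.1.surjective _
      obtain ⟨j, hj⟩ := hpre
      have h2 := π.near j
      rw [hj] at h2
      simp only at h2
      have hjm : m ≤ (j : ℕ) := by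
        by_contra! hlt
        have h3 := (mem_agreeBelow.1 h j hlt).symm.trans hj
        rw [← hρ ⟨m, by omega⟩ le_rfl] at h3
        have := congrArg Fin.val (ρ.1.injective h3)
        simp only at this
        omega
      by_cases hj1 : (j : ℕ) = m
      · have : j = ⟨m, by omega⟩ := Fin.ext hj1
        rw [this] at hj
        exact hne hj
      · have : j = ⟨m + 1, by omega⟩ := Fin.ext (by simp; omega)
        rw [this, h1] at hj
        have := congrArg Fin.val hj
        simp at this
    have hm2 : π.1 ⟨m + 2, hm⟩ = ⟨m + 1, by omega⟩ := by
      obtain ⟨j, hj⟩ : ∃ j, π.1 j = ⟨m + 1, by omega⟩ := π.1.surjective _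
      have h2 := π.near j
      rw [hj] at h2
      simp only at h2
      have e0 : (j : ℕ) ≠ m := by
        intro e
        have : j = ⟨m, by omega⟩ := Fin.ext e
        rw [this, hm0] at hj
        have := congrArg Fin.val hj
        simp at this
      have e1 : (j : ℕ) ≠ m + 1 := by
        intro e
        have : j = ⟨m + 1, by omega⟩ := Fin.ext e
        rw [this, h1] at hj
        have := congrArg Fin.val hj
        simp at this
      have : j = ⟨m + 2, hm⟩ := Fin.ext (by simp; omega)
      rw [← this, hj]
    rw [mem_agreeBelow]
    intro i hi
    by_cases hi1 : (i : ℕ) < m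
    · rw [hc' i (by omega) (by omega)]
      exact mem_agreeBelow.1 h i hi1
    by_cases hi0 : (i : ℕ) = m
    · rw [hc' i (by omega) (by omega), hρ i (by omega)]
      have : i = ⟨m, by omega⟩ := Fin.ext hi0
      rw [this, hm0]
    by_cases hi2 : (i : ℕ) = m + 1
    · have : i = ⟨m + 1, by omega⟩ := Fin.ext hi2
      rw [this, h1, ha]
    · have : i = ⟨m + 2, hm⟩ := Fin.ext (by simp; omega)
      rw [this, hm2, hb]

end FibPerm

/-! ### Output probabilities of the algorithm -/

namespace Greedy

open FibPerm

theorem mem_completions {n : ℕ} {s : State n} {π : FibPerm n} :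
    π ∈ completions s ↔ ∀ i v, s i = some v → π.1 i = v := by
  simp [completions]

theorem mem_options {n : ℕ} {s : State n} {i v : Fin n} :
    v ∈ options s i ↔ ∃ π ∈ completions s, π.1 i = v := by
  simp [options]

theorem mem_undetermined {n : ℕ} {s : State n} {i : Fin n} :
    i ∈ undetermined s ↔ 2 ≤ (options s i).card := by
  simp [undetermined]

theorem eq_none_of_mem_undetermined {n : ℕ} {s : State n} {i : Fin n}
    (hi : i ∈ undetermined s) : s i = none := by
  by_contra h
  obtain ⟨w, hw⟩ := Option.ne_none_iff_exists'.1 h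
  have h1 : options s i ⊆ {w} := by
    intro v hv
    obtain ⟨π, hπ, rfl⟩ := mem_options.1 hv
    exact Finset.mem_singleton.2 (mem_completions.1 hπ i w hw)
  have := Finset.card_le_card h1
  rw [mem_undetermined] at hi
  simp at this
  omega

/-- An undetermined index is unmatched, so the update overwrites no earlier match. -/
theorem mem_completions_update {n : ℕ} {s : State n} {i : Fin n} (hi : i ∈ undetermined s)
    {v : Fin n} {π : FibPerm n} :
    π ∈ completions (Function.update s i (some v)) ↔ π ∈ completions s ∧ π.1 i = v := by
  have hnone := eq_none_of_mem_undetermined hi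
  simp only [mem_completions]
  constructor
  · intro h
    refine ⟨fun j w hj => h j w ?_, h i v (by simp)⟩
    rw [Function.update_of_ne, hj]
    rintro rfl
    simp [hnone] at hj
  · rintro ⟨h, h1⟩ j w hj
    by_cases hji : j = i
    · subst hji
      simp at hj
      rw [h1, hj]
    · rw [Function.update_of_ne hji] at hj
      exact h j w hj

theorem min'_mem_undetermined {n : ℕ} {s : State n} (h : (nonSmallest s).Nonempty) :
    (nonSmallest s).min' h ∈ undetermined s :=
  (Finset.mem_filter.mp (Finset.min'_mem _ h)).1

/-- The probability that the algorithm, run for `k` steps from `s`, outputs `π`. -/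
noncomputable def outputProb {n : ℕ} (k : ℕ) (s : State n) (π : FibPerm n) : ENNReal :=
  ((run k s).map completions) {π}

open Classical in
theorem outputProb_succ {n : ℕ} (k : ℕ) {s : State n} (h : (nonSmallest s).Nonempty)
    (π : FibPerm n) :
    outputProb (k + 1) s π = ∑ v ∈ options s ((nonSmallest s).min' h),
      ((options s ((nonSmallest s).min' h)).card : ENNReal)⁻¹
        * outputProb k (Function.update s ((nonSmallest s).min' h) (some v)) π := by
  unfold outputProb
  rw [run, PMF.map_bind, step, dif_pos h, PMF.bind_map, PMF.bind_apply,
    tsum_eq_sum (s := options s ((nonSmallest s).min' h))]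
  · refine Finset.sum_congr rfl fun v hv => ?_
    rw [PMF.uniformOfFinset_apply_of_mem _ hv]
    rfl
  · intro v hv
    rw [PMF.uniformOfFinset_apply_of_notMem _ hv, zero_mul]

theorem outputProb_succ_of_not_nonempty {n : ℕ} (k : ℕ) {s : State n}
    (h : ¬ (nonSmallest s).Nonempty) (π : FibPerm n) :
    outputProb (k + 1) s π = outputProb k s π := by
  unfold outputProb
  rw [run, step, dif_neg h, PMF.pure_bind]

theorem outputProb_zero {n : ℕ} (s : State n) (π : FibPerm n) [Decidable ({π} = completions s)] :
    outputProb 0 s π = if {π} = completions s then 1 else 0 := by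
  unfold outputProb
  rw [run, PMF.pure_map, PMF.pure_apply]
  congr

theorem outputProb_of_notMem {n : ℕ} (k : ℕ) {s : State n} {π : FibPerm n}
    (hπ : π ∉ completions s) : outputProb k s π = 0 := by
  classical
  induction k generalizing s with
  | zero =>
    rw [outputProb_zero, if_neg]
    intro h
    exact hπ (h ▸ Finset.mem_singleton_self π)
  | succ k ih =>
    by_cases h : (nonSmallest s).Nonempty
    · rw [outputProb_succ k h]
      refine Finset.sum_eq_zero fun v _ => ?_
      rw [ih fun hmem => hπ ((mem_completions_update (min'_mem_undetermined h)).1 hmem).1, mul_zero]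
    · rw [outputProb_succ_of_not_nonempty k h, ih hπ]

/-- Matches are never undone, so only the branch that follows `π` can still output it. -/
theorem outputProb_succ_of_mem {n : ℕ} (k : ℕ) {s : State n} (h : (nonSmallest s).Nonempty)
    {i : Fin n} (hi : (nonSmallest s).min' h = i) {π : FibPerm n} (hπ : π ∈ completions s) :
    outputProb (k + 1) s π = ((options s i).card : ENNReal)⁻¹
        * outputProb k (Function.update s i (some (π.1 i))) π := by
  subst hi
  rw [outputProb_succ k h]
  refine Finset.sum_eq_single_of_mem _ (mem_options.2 ⟨π, hπ, rfl⟩) fun v _ hv => ?_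
  rw [outputProb_of_notMem, mul_zero]
  exact fun hmem => hv ((mem_completions_update (min'_mem_undetermined h)).1 hmem).2.symm

theorem outputProb_of_completions_eq_singleton {n : ℕ} (k : ℕ) {s : State n} {π : FibPerm n}
    (h : completions s = {π}) : outputProb k s π = 1 := by
  classical
  induction k with
  | zero => rw [outputProb_zero, if_pos h.symm]
  | succ k ih =>
    rw [outputProb_succ_of_not_nonempty, ih]
    rintro ⟨i, hi⟩
    have h1 := mem_undetermined.1 (Finset.mem_filter.1 hi).1
    simp [options, h] at h1

/-! ### The algorithm at a cut, and the recurrence for the phase sums -/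

section Cut

variable {n m : ℕ} {ρ : FibPerm n} {s : State n}

theorem mem_undetermined_iff_of_cut (hρ : ρ.FixesFrom m) (hm : m + 1 < n)
    (hs : completions s = agreeBelow ρ m) {i : Fin n} : i ∈ undetermined s ↔ m ≤ (i : ℕ) := by
  rw [mem_undetermined]
  constructor
  · intro h
    by_contra! hi
    have h1 : options s i ⊆ {ρ.1 i} := by
      intro v hv
      obtain ⟨π, hπ, rfl⟩ := mem_options.1 hv
      rw [hs] at hπ
      exact Finset.mem_singleton.2 (mem_agreeBelow.1 hπ i hi)
    have := Finset.card_le_card h1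
    simp at this
    omega
  · intro hi
    -- Swapping two neighbours beyond the cut gives a second value to each of them. The last index
    -- has to use its left neighbour, which lies beyond the cut because `m + 1 < n`.
    have key : ∀ a b : Fin n, (b : ℕ) = a + 1 → m ≤ (a : ℕ) → (i = a ∨ i = b) →
        2 ≤ (options s i).card := by
      intro a b hab ha hi'
      obtain ⟨ρ', h1, h2, h3⟩ := ρ.exists_swap hab (hρ a ha) (hρ b (by omega))
      have hmem : ρ' ∈ completions s := by
        rw [hs, mem_agreeBelow]
        intro j hj
        refine h3 j ?_ ?_ <;> (rintro rfl; omega)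
      refine Finset.one_lt_card.2 ⟨ρ.1 i, mem_options.2 ⟨ρ, hs ▸ self_mem_agreeBelow ρ m, rfl⟩,
        ρ'.1 i, mem_options.2 ⟨ρ', hmem, rfl⟩, ?_⟩
      have hne : a ≠ b := by rintro rfl; omega
      rw [hρ i hi]
      rcases hi' with rfl | rfl
      · rwa [h1]
      · rw [h2]; exact hne.symm
    by_cases hlt : (i : ℕ) + 1 < n
    · exact key i ⟨i + 1, hlt⟩ rfl hi (Or.inl rfl)
    · exact key ⟨i - 1, by omega⟩ i (by simp; omega) (by simp; omega) (Or.inr rfl)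

theorem mem_nonSmallest_iff_of_cut (hρ : ρ.FixesFrom m) (hm : m + 1 < n)
    (hs : completions s = agreeBelow ρ m) {i : Fin n} :
    i ∈ nonSmallest s ↔ m + 1 ≤ (i : ℕ) := by
  rw [nonSmallest, Finset.mem_filter]
  simp only [mem_undetermined_iff_of_cut hρ hm hs]
  constructor
  · rintro ⟨-, j, hj, hji⟩
    have : (j : ℕ) < i := hji
    omega
  · intro h
    exact ⟨by omega, ⟨m, by omega⟩, le_rfl, h⟩

theorem nonSmallest_nonempty_of_cut (hρ : ρ.FixesFrom m) (hm : m + 1 < n)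
    (hs : completions s = agreeBelow ρ m) : (nonSmallest s).Nonempty :=
  ⟨⟨m + 1, hm⟩, (mem_nonSmallest_iff_of_cut hρ hm hs).2 le_rfl⟩

theorem min'_nonSmallest_of_cut (hρ : ρ.FixesFrom m) (hm : m + 1 < n)
    (hs : completions s = agreeBelow ρ m) (h : (nonSmallest s).Nonempty) :
    (nonSmallest s).min' h = ⟨m + 1, hm⟩ := by
  refine le_antisymm (Finset.min'_le _ _ ((mem_nonSmallest_iff_of_cut hρ hm hs).2 le_rfl)) ?_
  exact (mem_nonSmallest_iff_of_cut hρ hm hs).1 (Finset.min'_mem _ h)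

theorem options_of_cut_of_lt (hρ : ρ.FixesFrom m) (hm : m + 2 < n)
    (hs : completions s = agreeBelow ρ m) :
    options s ⟨m + 1, by omega⟩ = {⟨m, by omega⟩, ⟨m + 1, by omega⟩, ⟨m + 2, hm⟩} := by
  ext v
  simp only [mem_options, hs, Finset.mem_insert, Finset.mem_singleton]
  constructor
  · rintro ⟨π, -, rfl⟩
    have h := π.near ⟨m + 1, by omega⟩
    simp only at h
    simp only [Fin.ext_iff]
    omega
  · rintro (rfl | rfl | rfl)
    · obtain ⟨ρ', -, h⟩ := exists_child_swap_left hρ (show m + 1 < n by omega)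
      exact ⟨ρ', (h ρ').1 (self_mem_agreeBelow _ _)⟩
    · obtain ⟨ρ', -, h⟩ := exists_child_fixed hρ (show m + 1 < n by omega)
      exact ⟨ρ', (h ρ').1 (self_mem_agreeBelow _ _)⟩
    · obtain ⟨ρ', -, h⟩ := exists_child_swap_right hρ hm
      exact ⟨ρ', (h ρ').1 (self_mem_agreeBelow _ _)⟩

theorem options_of_cut_of_eq (hρ : ρ.FixesFrom m) (hm : m + 2 = n)
    (hs : completions s = agreeBelow ρ m) :
    options s ⟨m + 1, by omega⟩ = {⟨m, by omega⟩, ⟨m + 1, by omega⟩} := by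
  ext v
  simp only [mem_options, hs, Finset.mem_insert, Finset.mem_singleton]
  constructor
  · rintro ⟨π, -, rfl⟩
    have h := π.near ⟨m + 1, by omega⟩
    have h2 := (π.1 ⟨m + 1, by omega⟩).2
    simp only at h
    simp only [Fin.ext_iff]
    omega
  · rintro (rfl | rfl)
    · obtain ⟨ρ', -, h⟩ := exists_child_swap_left hρ (show m + 1 < n by omega)
      exact ⟨ρ', (h ρ').1 (self_mem_agreeBelow _ _)⟩
    · obtain ⟨ρ', -, h⟩ := exists_child_fixed hρ (show m + 1 < n by omega)
      exact ⟨ρ', (h ρ').1 (self_mem_agreeBelow _ _)⟩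

/-- The summand of the characteristic function of `log T` that belongs to output probability `x`. -/
noncomputable def phase (τ x : ℝ) : ℂ := Complex.exp (Complex.I * (τ * Real.log x⁻¹ : ℝ))

theorem phase_natCast_inv_mul (τ : ℝ) {c : ℕ} (hc : c ≠ 0) {x : ℝ} (hx : 0 < x) :
    phase τ ((c : ℝ)⁻¹ * x) = Complex.exp (Complex.I * (τ * Real.log c : ℝ)) * phase τ x := by
  have hc' : (c : ℝ) ≠ 0 := by exact_mod_cast hc
  rw [phase, phase, mul_inv, inv_inv, Real.log_mul hc' (inv_ne_zero hx.ne'), ← Complex.exp_add]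
  congr 1
  push_cast
  ring

/-- The output probabilities over the class cut at `m` are positive, and their phases sum to
`z`. -/
def PhaseSum {n : ℕ} (τ : ℝ) (ρ : FibPerm n) (m k : ℕ) (s : State n) (z : ℂ) : Prop :=
  (∀ π ∈ agreeBelow ρ m, 0 < (outputProb k s π).toReal) ∧
    ∑ π ∈ agreeBelow ρ m, phase τ (outputProb k s π).toReal = z

-- A choice among `c` options divides each probability by `c`, hence multiplies each phase by `exp
-- (i τ log c)`. The chosen values split the class into subclasses. Positivity is carried along
-- because the logarithm of the product must split.
open Classical in
theorem phaseSum_succ {τ : ℝ} {k : ℕ} (hρ : ρ.FixesFrom m) (hm : m + 1 < n)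
    (hs : completions s = agreeBelow ρ m) (z : Fin n → ℂ)
    (hz : ∀ v ∈ options s ⟨m + 1, hm⟩, ∃ (ρ' : FibPerm n) (m' : ℕ),
      (∀ π, π ∈ agreeBelow ρ' m' ↔ π ∈ agreeBelow ρ m ∧ π.1 ⟨m + 1, hm⟩ = v) ∧
      PhaseSum τ ρ' m' k (Function.update s ⟨m + 1, hm⟩ (some v)) (z v)) :
    PhaseSum τ ρ m (k + 1) s
      (Complex.exp (Complex.I * (τ * Real.log (options s ⟨m + 1, hm⟩).card : ℝ))
        * ∑ v ∈ options s ⟨m + 1, hm⟩, z v) := by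
  have hne := nonSmallest_nonempty_of_cut hρ hm hs
  have hmin := min'_nonSmallest_of_cut hρ hm hs hne
  have hcard : (options s ⟨m + 1, hm⟩).card ≠ 0 := by
    have := mem_undetermined.1 ((mem_undetermined_iff_of_cut hρ hm hs (i := ⟨m + 1, hm⟩)).2
      (by simp))
    omega
  have hprob : ∀ π ∈ agreeBelow ρ m, (outputProb (k + 1) s π).toReal
      = ((options s ⟨m + 1, hm⟩).card : ℝ)⁻¹
        * (outputProb k (Function.update s ⟨m + 1, hm⟩ (some (π.1 ⟨m + 1, hm⟩))) π).toReal := by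
    intro π hπ
    rw [outputProb_succ_of_mem k hne hmin (hs ▸ hπ), ENNReal.toReal_mul, ENNReal.toReal_inv,
      ENNReal.toReal_natCast]
  have hopt : ∀ π ∈ agreeBelow ρ m, π.1 ⟨m + 1, hm⟩ ∈ options s ⟨m + 1, hm⟩ := fun π hπ =>
    mem_options.2 ⟨π, hs ▸ hπ, rfl⟩
  have hpos : ∀ π ∈ agreeBelow ρ m,
      0 < (outputProb k (Function.update s ⟨m + 1, hm⟩ (some (π.1 ⟨m + 1, hm⟩))) π).toReal := by
    intro π hπ
    obtain ⟨ρ', m', h1, h2, -⟩ := hz _ (hopt π hπ)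
    exact h2 π ((h1 π).2 ⟨hπ, rfl⟩)
  have hcard' : (0 : ℝ) < (options s ⟨m + 1, hm⟩).card := by
    exact_mod_cast Nat.pos_of_ne_zero hcard
  refine ⟨fun π hπ => ?_, ?_⟩
  · rw [hprob π hπ]
    exact mul_pos (inv_pos.2 hcard') (hpos π hπ)
  · rw [← Finset.sum_fiberwise_of_maps_to hopt, Finset.mul_sum]
    refine Finset.sum_congr rfl fun v hv => ?_
    obtain ⟨ρ', m', h1, -, h3⟩ := hz v hv
    have hset : (agreeBelow ρ m).filter (fun π => π.1 ⟨m + 1, hm⟩ = v) = agreeBelow ρ' m' := by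
      ext π
      rw [Finset.mem_filter, h1]
    rw [← h3, Finset.mul_sum, hset]
    refine Finset.sum_congr rfl fun π hπ => ?_
    obtain ⟨hπ1, hπ2⟩ := (h1 π).1 hπ
    rw [hprob π hπ1, phase_natCast_inv_mul τ hcard (hpos π hπ1), hπ2]

/-- Strong induction on the number `r` of indices beyond the cut. Each step settles at least two of
them, so `r` steps suffice. -/
theorem phaseSum_of_cut (τ : ℝ) (r : ℕ) (hr : m + r = n) {k : ℕ} (hk : r ≤ k)
    (hρ : ρ.FixesFrom m) (hs : completions s = agreeBelow ρ m) :
    PhaseSum τ ρ m k s (weightSum (Complex.exp (Complex.I * (τ * Real.log 2 : ℝ)))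
      (Complex.exp (Complex.I * (τ * Real.log 3 : ℝ))) r) := by
  classical
  induction r using Nat.strong_induction_on generalizing m ρ s k with
  | _ r ih =>
  have hsingle : r ≤ 1 → PhaseSum τ ρ m k s 1 := by
    intro hr1
    have h1 := agreeBelow_eq_singleton hρ (by omega)
    have h2 := outputProb_of_completions_eq_singleton k (hs.trans h1)
    simp [PhaseSum, h1, h2, phase]
  have hcut : ∀ (hm : m + 1 < n) (ρ' : FibPerm n) (m' : ℕ) (v : Fin n),
      (∀ π, π ∈ agreeBelow ρ' m' ↔ π ∈ agreeBelow ρ m ∧ π.1 ⟨m + 1, hm⟩ = v) →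
      completions (Function.update s ⟨m + 1, hm⟩ (some v)) = agreeBelow ρ' m' := by
    intro hm ρ' m' v h
    ext π
    rw [mem_completions_update ((mem_undetermined_iff_of_cut hρ hm hs).2 (by simp)), h, hs]
  match r, hr, hk, ih with
  | 0, _, _, _ => exact hsingle (by omega)
  | 1, _, _, _ => exact hsingle (by omega)
  | 2, hr, hk, ih =>
    obtain ⟨k, rfl⟩ : ∃ j, k = j + 1 := ⟨k - 1, by omega⟩
    have hm : m + 1 < n := by omega
    have hopt := options_of_cut_of_eq hρ hr hs
    have := phaseSum_succ (τ := τ) (k := k) hρ hm hs (fun _ => 1) (by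
      intro v hv
      rw [hopt] at hv
      simp only [Finset.mem_insert, Finset.mem_singleton] at hv
      rcases hv with rfl | rfl
      · obtain ⟨ρ', hf, h⟩ := exists_child_swap_left hρ hm
        exact ⟨ρ', m + 2, h, ih 0 (by omega) (by omega) (by omega) hf (hcut hm _ _ _ h)⟩
      · obtain ⟨ρ', hf, h⟩ := exists_child_fixed hρ hm
        exact ⟨ρ', m + 2, h, ih 0 (by omega) (by omega) (by omega) hf (hcut hm _ _ _ h)⟩)
    have hc : (options s ⟨m + 1, hm⟩).card = 2 := by
      rw [hopt, Finset.card_pair (by simp)]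
    rw [Finset.sum_const, hc] at this
    simpa [weightSum, mul_comm] using this
  | r + 3, hr, hk, ih =>
    obtain ⟨k, rfl⟩ : ∃ j, k = j + 1 := ⟨k - 1, by omega⟩
    have hm : m + 1 < n := by omega
    have hm2 : m + 2 < n := by omega
    have hopt := options_of_cut_of_lt hρ hm2 hs
    set a := Complex.exp (Complex.I * (τ * Real.log 2 : ℝ))
    set b := Complex.exp (Complex.I * (τ * Real.log 3 : ℝ))
    have := phaseSum_succ (τ := τ) (k := k) hρ hm hs
      -- Only the upward value `m + 2` settles three indices; the other two values settle two.
      (fun v => if (v : ℕ) = m + 2 then weightSum a b r else weightSum a b (r + 1)) (by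
      intro v hv
      rw [hopt] at hv
      simp only [Finset.mem_insert, Finset.mem_singleton] at hv
      rcases hv with rfl | rfl | rfl
      · obtain ⟨ρ', hf, h⟩ := exists_child_swap_left hρ hm
        refine ⟨ρ', m + 2, h, ?_⟩
        rw [if_neg (by simp)]
        exact ih (r + 1) (by omega) (by omega) (by omega) hf (hcut hm _ _ _ h)
      · obtain ⟨ρ', hf, h⟩ := exists_child_fixed hρ hm
        refine ⟨ρ', m + 2, h, ?_⟩
        rw [if_neg (by simp)]
        exact ih (r + 1) (by omega) (by omega) (by omega) hf (hcut hm _ _ _ h)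
      · obtain ⟨ρ', hf, h⟩ := exists_child_swap_right hρ hm2
        refine ⟨ρ', m + 3, h, ?_⟩
        rw [if_pos rfl]
        exact ih r (by omega) (by omega) (by omega) hf (hcut hm _ _ _ h))
    have hc : (options s ⟨m + 1, hm⟩).card = 3 := by
      rw [hopt, Finset.card_eq_three]
      exact ⟨_, _, _, by simp, by simp, by simp, rfl⟩
    rw [hc, hopt, Finset.sum_insert (by simp), Finset.sum_pair (by simp)] at this
    simp only [Nat.cast_ofNat] at this
    rw [if_neg (by omega), if_neg (by omega), if_pos trivial] at this
    convert this using 1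
    rw [weightSum]
    ring

end Cut

theorem sum_phase_P (n : ℕ) (τ : ℝ) :
    ∑ π : FibPerm n, phase τ (P π) = weightSum (Complex.exp (Complex.I * (τ * Real.log 2 : ℝ)))
      (Complex.exp (Complex.I * (τ * Real.log 3 : ℝ))) n := by
  classical
  let ρ : FibPerm n := ⟨1, fun i => by simp⟩
  have h1 : completions (fun _ => none : State n) = agreeBelow ρ 0 := by
    ext π
    simp [mem_completions, mem_agreeBelow]
  have h2 : agreeBelow ρ 0 = Finset.univ := by
    ext π
    simp [mem_agreeBelow]
  have h3 := (phaseSum_of_cut τ n (m := 0) (by omega) le_rfl (fun i _ => rfl) h1).2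
  rw [h2] at h3
  exact h3

/-- At `τ = 0` every phase is 1. -/
theorem card_fibPerm (n : ℕ) : (Fintype.card (FibPerm n) : ℂ) = weightSum 1 1 n := by
  have := sum_phase_P n 0
  simpa [phase] using this

end Greedy

/-! ### Numerical values, characteristic functions and the limit theorem -/

namespace Greedy

theorem mean_variance_approx : |mean - 0.4913| < 0.00005 ∧ |variance - 0.0195| < 0.00005 := by
  obtain ⟨h1, h2⟩ := sqrt_five_mem
  have h3 := Real.log_three_gt_d9
  have h4 := Real.log_three_lt_d9
  have h0 : 0 < √5 := by linarith
  constructor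
  · have e1 : 0.49130 < Real.log 3 / √5 := by rw [lt_div_iff₀ h0]; linarith
    have e2 : Real.log 3 / √5 < 0.49132 := by rw [div_lt_iff₀ h0]; linarith
    rw [mean, abs_lt]
    constructor <;> linarith
  · have e1 : 0.01612 < 1 - 11 / (5 * √5) := by
      have : 11 / (5 * √5) < 0.98388 := by rw [div_lt_iff₀ (by linarith)]; linarith
      linarith
    have e2 : 1 - 11 / (5 * √5) < 0.01614 := by
      have : 0.98386 < 11 / (5 * √5) := by rw [lt_div_iff₀ (by linarith)]; linarith
      linarith
    have e3 : 1.2069 < Real.log 3 ^ 2 := by nlinarith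
    have e4 : Real.log 3 ^ 2 < 1.2070 := by nlinarith
    rw [variance, abs_lt]
    constructor <;> nlinarith

theorem variance_pos : 0 < variance := by
  have h := Real.log_pos (show (1 : ℝ) < 3 by norm_num)
  exact mul_pos renewalVariance_pos (by positivity)

/-- The frequency per ternary choice is `s = t * log 3 / (√variance * √n)`. Centring by `mean * n`
becomes the factor `exp (-i s n / √5)`, since `mean = log 3 / √5`. -/
theorem charFun_normalized (n : ℕ) (t : ℝ) :
    MeasureTheory.charFun ((FibPerm.uniform n).map fun π : FibPerm n =>
        (Real.log (T π) - mean * n) / (√variance * √(n : ℝ))) t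
      = weightSum (Complex.exp (Complex.I * (t / √variance / √(n : ℝ) * Real.log 2 : ℝ)))
          (Complex.exp (Complex.I * (t * Real.log 3 / √variance / √(n : ℝ) : ℝ))) n
        / weightSum 1 1 n
        * Complex.exp (-(Complex.I * (t * Real.log 3 / √variance / √(n : ℝ) : ℝ)
          / (√5 : ℝ) * n)) := by
  have : MeasurableSingletonClass (FibPerm n) := ⟨fun _ => trivial⟩
  rw [MeasureTheory.charFun_apply_real, MeasureTheory.integral_map
    (measurable_from_top).aemeasurable (by fun_prop), FibPerm.uniform, PMF.integral_eq_sum]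
  have e : t * Real.log 3 / √variance / √(n : ℝ) = t / √variance / √(n : ℝ) * Real.log 3 := by ring
  rw [e, ← sum_phase_P, ← card_fibPerm, div_eq_mul_inv, mul_assoc, Finset.sum_mul]
  refine Finset.sum_congr rfl fun π _ => ?_
  rw [PMF.uniformOfFintype_apply, ENNReal.toReal_inv, ENNReal.toReal_natCast, phase, mul_left_comm,
    ← Complex.exp_add, T, Complex.real_smul, Complex.ofReal_inv, Complex.ofReal_natCast]
  congr 2
  simp only [mean]
  push_cast
  ring

end Greedy

open Filter Topology MeasureTheory in
theorem mainTheorem2 :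
    MeasureTheory.TendstoInDistribution
      (fun (n : ℕ) (π : FibPerm n) =>
        (Real.log (Greedy.T π) - Greedy.mean * n) / (√Greedy.variance * √(n : ℝ)))
      Filter.atTop (id : ℝ → ℝ) FibPerm.uniform (ProbabilityTheory.gaussianReal 0 1)
    ∧ |Greedy.mean - 0.4913| < 0.00005 ∧ |Greedy.variance - 0.0195| < 0.00005 := by
  refine ⟨⟨fun n => measurable_from_top.aemeasurable, aemeasurable_id, ?_⟩,
    Greedy.mean_variance_approx⟩
  refine MeasureTheory.ProbabilityMeasure.tendsto_iff_tendsto_charFun.2 fun t => ?_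
  have h0 := Greedy.variance_pos
  -- The binary choice occurs at most once, so its weight enters only through an initial value; as
  -- it tends to 1, `log 2` leaves no trace in the limit.
  have ha : Filter.Tendsto (fun n : ℕ => Complex.exp (Complex.I *
      (t / √Greedy.variance / √(n : ℝ) * Real.log 2 : ℝ))) Filter.atTop (nhds 1) := by
    have h1 : Filter.Tendsto (fun n : ℕ => t / √Greedy.variance / √(n : ℝ)) Filter.atTop (nhds 0) :=
      Greedy.tendsto_div_sqrt _
    have h2 : Continuous fun x : ℝ => Complex.exp (Complex.I * (x * Real.log 2 : ℝ)) := by fun_prop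
    have h3 : Filter.Tendsto (fun x : ℝ => Complex.exp (Complex.I * (x * Real.log 2 : ℝ)))
        (nhds 0) (nhds 1) := by simpa using h2.tendsto 0
    exact h3.comp h1
  have h := Greedy.tendsto_weightSum_div (fun n => by
    rw [mul_comm]; exact Complex.norm_exp_ofReal_mul_I _) ha (t * Real.log 3 / √Greedy.variance)
  -- The normalization is exact: `variance` is `renewalVariance` times `log 3 ^ 2`.
  have hlim : (Greedy.renewalVariance : ℂ) * ((t * Real.log 3 / √Greedy.variance : ℝ) : ℂ) ^ 2 / 2
      = (t : ℂ) ^ 2 / 2 := by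
    have h1 : Greedy.renewalVariance * (t * Real.log 3 / √Greedy.variance) ^ 2 = t ^ 2 := by
      rw [div_pow, Real.sq_sqrt h0.le, mul_pow, mul_div_assoc', div_eq_iff h0.ne']
      simp only [Greedy.variance, Greedy.renewalVariance]
      ring
    have h2 : (Greedy.renewalVariance : ℂ) * ((t * Real.log 3 / √Greedy.variance : ℝ) : ℂ) ^ 2
      = (t : ℂ) ^ 2 := by exact_mod_cast h1
    rw [h2]
  rw [hlim] at h
  simp only [MeasureTheory.ProbabilityMeasure.coe_mk, Measure.map_id,
    ProbabilityTheory.charFun_gaussianReal]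
  simp only [Greedy.charFun_normalized]
  convert h using 2
  simp
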